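/- Let $G\subseteq K_{m,n}$ be a connected bipartite graph with vertex classes $U_1,U_2$, $|U_1|=m$, $|U_2|=n$. Let $M_{\mathbb Q}=\{x\in\mathbb Q^{m+n}:\sum_{v\in U_1}x_v=\sum_{v\in U_2}x_v\}$ and let $N_{\mathbb Q}=\mathbb Q^{m+n}/\langle\sum_i e_i-\sum_j f_j\rangle$ be its dual space. For a spanning subgraph $H$ of $G$ let $\sigma_H^\vee\subseteq M_{\mathbb Q}$ be the cone generated by the vectors $e^i+f^j$ for the edges $(i,j)$ of $H$, and let $\sigma_G\subseteq N_{\mathbb Q}$ (the edge cone) be the dual cone of $\sigma_G^\vee$. Independent sets are non-empty by convention; write $N(A)$ for the set of neighbours of $A$ and $A_i=A\cap U_i$. An independent set $A$ is two-sided if $\emptyset\ne A_i\subsetneq U_i$ for $i=1,2$. Let $\mathcal I_G^{(*)}$ consist of the two-sided maximal independent sets and of the independent sets $U_i\setminus\{u\}$ ($u\in U_i$) that are contained in no two-sided independent set. For $A\in\mathcal I_G^{(*)}$ let $G\{A\}$ be the spanning subgraph of $G$ whose edges are those of the induced subgraphs on $A_1\cup N(A_1)$ and on $A_2\cup N(A_2)$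 if $A$ is two-sided, and those of the induced subgraphs on $A\cup N(A)$ and on $(U_i\setminus A)\cup(U_j\setminus N(A))$, $\{i,j\}=\{1,2\}$, if $A\subseteq U_i$. Call $A\in\mathcal I_G^{(*)}$ a first independent set if $G\{A\}$ has exactly two connected components; then put $$\pi(A)=\{x\in\sigma_G:\langle y,x\rangle=0\text{ for all }y\in\sigma_G^\vee\text{ with }\textstyle\sum_{v\in A_i}y_v=\sum_{v\in N(A_i)}y_v\},$$ where $i$ is such that $A_i\neq\emptyset$ (this is the extremal ray of $\sigma_G$ corresponding to $A$). Let $S$ be a set of $d$ first independent sets, let $G[S]=\bigcap_{A\in S}G\{A\}$ (with $G[\emptyset]=G$), and let $\mathrm{Val}_S\in M_{\mathbb Q}$ be the degree sequence of $G[S]$. By the face of $\sigma_G$ spanned by $\pi(S)$ we mean the smallest face of $\sigma_G$ containing all the rays $\pi(A)$, $A\in S$. Then: 1. $\pi(S)$ spans a face of dimension $d$ if and only if $\dim\sigma^\vee_{G[S]}=m+n-d-1$, if and only if $G[S]$ has $d+1$ connected components. 2. The face spanned by $\pi(S)$ is $H_{\mathrm{Val}_S}\cap\sigma_G$, where $H_{\mathrm{Val}_S}=\{x\in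 N_{\mathbb Q}:\langle \mathrm{Val}_S,x\rangle=0\}$. 3. In particular, if the cone generated by the rays $\pi(A)$, $A\in S$, is itself a face of $\sigma_G$ of dimension $d$, then $G[S]$ has $d+1$ connected components and this cone equals $H_{\mathrm{Val}_S}\cap\sigma_G$. -/

import Mathlib

/-! Edge cones of bipartite graphs `G ⊆ K_{m,n}`. The vertex set is `Fin m ⊕ Fin n`, with
`U₁` the left and `U₂` the right summand. -/

namespace EdgeCone

/-- The vertex set of `K_{m,n}`. -/
abbrev Vert (m n : ℕ) : Type := Fin m ⊕ Fin n

/-! ### The vector spaces `M_ℚ` and `N_ℚ` -/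

/-- The vector `(1,…,1,-1,…,-1) = ∑ e_i - ∑ f_j`. -/
def signVec (m n : ℕ) : Vert m n → ℚ := Sum.elim (fun _ => 1) (fun _ => -1)

/-- `M_ℚ = ℚ^{m+n} ∩ (1,-1)^⊥`. -/
def MQ (m n : ℕ) : Submodule ℚ (Vert m n → ℚ) where
  carrier := {x | ∑ v, x v * signVec m n v = 0}
  zero_mem' := by simp
  add_mem' {x y} hx hy := by
    simp only [Set.mem_ofPred_eq, Pi.add_apply, add_mul, Finset.sum_add_distrib] at *
    rw [hx, hy, add_zero]
  smul_mem' c x hx := by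
    simp only [Set.mem_ofPred_eq, Pi.smul_apply, smul_eq_mul, mul_assoc, ← Finset.mul_sum] at *
    rw [hx, mul_zero]

/-- `N_ℚ = ℚ^{m+n} / ⟨(1,-1)⟩`. -/
abbrev NQ (m n : ℕ) : Type := (Vert m n → ℚ) ⧸ Submodule.span ℚ {signVec m n}

/-- The standard pairing of a coordinate vector with an element of `M_ℚ`. -/
def coordPairing (m n : ℕ) : (Vert m n → ℚ) →ₗ[ℚ] MQ m n →ₗ[ℚ] ℚ :=
  LinearMap.mk₂ ℚ (fun x y => ∑ v, (y : Vert m n → ℚ) v * x v)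
    (by intro x x' y; simp [mul_add, Finset.sum_add_distrib])
    (by
      intro c x y
      rw [smul_eq_mul, Finset.mul_sum]
      exact Finset.sum_congr rfl fun v _ => by simp [mul_left_comm])
    (by intro x y y'; simp [add_mul, Finset.sum_add_distrib])
    (by
      intro c x y
      rw [smul_eq_mul, Finset.mul_sum]
      exact Finset.sum_congr rfl fun v _ => by simp [mul_assoc])

theorem span_signVec_le_ker (m n : ℕ) :
    Submodule.span ℚ {signVec m n} ≤ LinearMap.ker (coordPairing m n) := by
  rw [Submodule.span_singleton_le_iff_mem, LinearMap.mem_ker]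
  ext y
  exact y.2

/-- The pairing `⟨y, x⟩` of `y ∈ M_ℚ` and `x ∈ N_ℚ`. -/
def pairing (m n : ℕ) : MQ m n →ₗ[ℚ] NQ m n →ₗ[ℚ] ℚ :=
  (Submodule.liftQ _ (coordPairing m n) (span_signVec_le_ker m n)).flip

theorem pairing_mk {m n : ℕ} (y : MQ m n) (x : Vert m n → ℚ) :
    pairing m n y (Submodule.Quotient.mk x) = ∑ v, (y : Vert m n → ℚ) v * x v := rfl

/-! ### Cones -/

/-- The dimension of a cone: the dimension of its linear span. -/
noncomputable def coneDim {E : Type*} [AddCommGroup E] [Module ℚ E] (C : PointedCone ℚ E) : ℕ :=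
  Module.finrank ℚ (Submodule.span ℚ (C : Set E))

/-- `τ` is the face of `σ` spanned by a family `R` of rays (subcones) of `σ`:
the smallest face of `σ` that contains all of them. -/
def IsFaceSpannedBy {E : Type*} [AddCommGroup E] [Module ℚ E]
    (σ : PointedCone ℚ E) (R : Set (PointedCone ℚ E)) (τ : PointedCone ℚ E) : Prop :=
  IsLeast {F : PointedCone ℚ E | F.IsFaceOf σ ∧ ∀ ρ ∈ R, ρ ≤ F} τ

/-- The vector `e^i + f^j` of `M_ℚ`. -/
def edgeVec {m n : ℕ} (i : Fin m) (j : Fin n) : MQ m n :=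
  ⟨Pi.single (Sum.inl i) 1 + Pi.single (Sum.inr j) 1, by
    simp [MQ, signVec, Pi.single_apply]⟩

/-- The dual edge cone `σ_G^∨ ⊆ M_ℚ`, generated by `e^i + f^j` for the edges `(i,j)` of `G`. -/
def dualEdgeCone {m n : ℕ} (G : SimpleGraph (Vert m n)) : PointedCone ℚ (MQ m n) :=
  PointedCone.hull ℚ {y | ∃ i j, G.Adj (Sum.inl i) (Sum.inr j) ∧ y = edgeVec i j}

/-- The edge cone `σ_G ⊆ N_ℚ`. -/
def edgeCone {m n : ℕ} (G : SimpleGraph (Vert m n)) : PointedCone ℚ (NQ m n) :=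
  PointedCone.dual (pairing m n) (dualEdgeCone G : Set (MQ m n))

/-- `H_y = {x ∈ N_ℚ | ⟨y, x⟩ = 0}`. -/
def hyperplane {m n : ℕ} (y : MQ m n) : Submodule ℚ (NQ m n) := LinearMap.ker (pairing m n y)

/-- `H_y ∩ σ_G`. -/
def hyperplaneSection {m n : ℕ} (G : SimpleGraph (Vert m n)) (y : MQ m n) :
    PointedCone ℚ (NQ m n) :=
  PointedCone.ofSubmodule (hyperplane y) ⊓ edgeCone G

/-- The annihilator `F^⊥ ⊆ N_ℚ` of a subset `F` of `M_ℚ`. -/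
def annihilator {m n : ℕ} (F : Set (MQ m n)) : Submodule ℚ (NQ m n) :=
  ⨅ y ∈ F, hyperplane y

/-- `F^* = F^⊥ ∩ σ_G`, for `F ⊆ σ_G^∨`. -/
def dualFace {m n : ℕ} (G : SimpleGraph (Vert m n)) (F : Set (MQ m n)) :
    PointedCone ℚ (NQ m n) :=
  PointedCone.ofSubmodule (annihilator F) ⊓ edgeCone G

/-! ### Independent sets -/

/-- `U₁`. -/
def U₁ (m n : ℕ) : Finset (Vert m n) := Finset.univ.filter fun v => v.isLeft

/-- `U₂`. -/
def U₂ (m n : ℕ) : Finset (Vert m n) := Finset.univ.filter fun v => v.isRight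

open Classical in
/-- The neighbour set `N(A)`. -/
noncomputable def nbr {m n : ℕ} (G : SimpleGraph (Vert m n)) (A : Finset (Vert m n)) :
    Finset (Vert m n) :=
  Finset.univ.filter fun v => ∃ u ∈ A, G.Adj u v

/-- Independent sets are non-empty by convention. -/
def IsIndependent {m n : ℕ} (G : SimpleGraph (Vert m n)) (A : Finset (Vert m n)) : Prop :=
  A.Nonempty ∧ G.IsIndepSet (A : Set (Vert m n))

/-- Two-sided independent sets `A = A₁ ⊔ A₂` with `∅ ≠ A₁ ⊊ U₁` and `∅ ≠ A₂ ⊊ U₂`. -/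
def IsTwoSided {m n : ℕ} (G : SimpleGraph (Vert m n)) (A : Finset (Vert m n)) : Prop :=
  IsIndependent G A ∧
    (A ∩ U₁ m n).Nonempty ∧ A ∩ U₁ m n ⊂ U₁ m n ∧
    (A ∩ U₂ m n).Nonempty ∧ A ∩ U₂ m n ⊂ U₂ m n

/-- The collection `I_G^(*)`: the two-sided maximal independent sets, and the independent sets
`U_i \ {u}` (with `u ∈ U_i`) which are contained in no two-sided independent set. -/
def IsStarSet {m n : ℕ} (G : SimpleGraph (Vert m n)) (A : Finset (Vert m n)) : Prop :=
  (IsTwoSided G A ∧ Maximal (IsIndependent G) A) ∨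
    (IsIndependent G A ∧
      ((∃ u ∈ U₁ m n, A = U₁ m n \ {u}) ∨ (∃ u ∈ U₂ m n, A = U₂ m n \ {u})) ∧
      ∀ B, IsTwoSided G B → ¬ A ⊆ B)

/-- The induced subgraph `G[P]`, as a graph on all vertices (those outside `P` are isolated). -/
def inducedOn {m n : ℕ} (G : SimpleGraph (Vert m n)) (P : Finset (Vert m n)) :
    SimpleGraph (Vert m n) :=
  (G.induce (P : Set (Vert m n))).spanningCoe

open Classical in
/-- The spanning subgraph `G{A}` associated to an independent set `A`. -/
noncomputable def assocGraph {m n : ℕ} (G : SimpleGraph (Vert m n)) (A : Finset (Vert m n)) :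
    SimpleGraph (Vert m n) :=
  if A ⊆ U₁ m n then
    inducedOn G (A ∪ nbr G A) ⊔ inducedOn G ((U₁ m n \ A) ∪ (U₂ m n \ nbr G A))
  else if A ⊆ U₂ m n then
    inducedOn G (A ∪ nbr G A) ⊔ inducedOn G ((U₂ m n \ A) ∪ (U₁ m n \ nbr G A))
  else
    inducedOn G ((A ∩ U₁ m n) ∪ nbr G (A ∩ U₁ m n)) ⊔
      inducedOn G ((A ∩ U₂ m n) ∪ nbr G (A ∩ U₂ m n))

/-- The number of connected components of a graph. -/
noncomputable def numComponents {V : Type*} (G : SimpleGraph V) : ℕ :=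
  Nat.card G.ConnectedComponent

/-- First independent sets: those `A ∈ I_G^(*)` for which `G{A}` has two components. -/
def IsFirstIndependent {m n : ℕ} (G : SimpleGraph (Vert m n)) (A : Finset (Vert m n)) : Prop :=
  IsStarSet G A ∧ numComponents (assocGraph G A) = 2

/-- `𝓗_A = {x ∈ M_ℚ | ∑_{v ∈ A} x_v = ∑_{v ∈ N(A)} x_v}`. -/
def indepHyperplane {m n : ℕ} (G : SimpleGraph (Vert m n)) (A : Finset (Vert m n)) :
    Set (MQ m n) :=
  {x | ∑ v ∈ A, (x : Vert m n → ℚ) v = ∑ v ∈ nbr G A, (x : Vert m n → ℚ) v}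

open Classical in
/-- A non-empty one of the two parts `A₁ = A ∩ U₁`, `A₂ = A ∩ U₂` of `A`. -/
noncomputable def chosenSide {m n : ℕ} (A : Finset (Vert m n)) : Finset (Vert m n) :=
  if (A ∩ U₁ m n).Nonempty then A ∩ U₁ m n else A ∩ U₂ m n

/-- `π(A) = (𝓗_{A_i} ∩ σ_G^∨)^*` for an `i` with `A_i ≠ ∅`, as a subcone of `σ_G`. -/
noncomputable def extremalRay {m n : ℕ} (G : SimpleGraph (Vert m n)) (A : Finset (Vert m n)) :
    PointedCone ℚ (NQ m n) :=
  dualFace G (indepHyperplane G (chosenSide A) ∩ (dualEdgeCone G : Set (MQ m n)))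

/-! ### The intersection graph and its degree sequence -/

/-- `G[S] = ⋂_{A ∈ S} G{A}`, a spanning subgraph of `G`; it is `G` itself for `S = ∅`. -/
noncomputable def interGraph {m n : ℕ} (G : SimpleGraph (Vert m n))
    (S : Finset (Finset (Vert m n))) : SimpleGraph (Vert m n) :=
  G ⊓ ⨅ A ∈ S, assocGraph G A

theorem interGraph_le {m n : ℕ} (G : SimpleGraph (Vert m n))
    (S : Finset (Finset (Vert m n))) : interGraph G S ≤ G := inf_le_left

open Classical in
theorem degree_mem_MQ {m n : ℕ} (G : SimpleGraph (Vert m n))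
    (hG : G ≤ completeBipartiteGraph (Fin m) (Fin n)) :
    (fun v => (G.degree v : ℚ)) ∈ MQ m n := by
  have hl : ∀ i : Fin m, (G.degree (Sum.inl i) : ℚ)
      = ∑ j : Fin n, if G.Adj (Sum.inl i) (Sum.inr j) then 1 else 0 := by
    intro i
    have h : ∀ i' : Fin m, ¬ G.Adj (Sum.inl i) (Sum.inl i') := fun i' h => by
      simpa using hG h
    rw [← SimpleGraph.card_neighborFinset_eq_degree, SimpleGraph.neighborFinset_eq_filter,
      Finset.card_filter]
    rw [Fintype.sum_sum_type]
    push_cast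
    simp only [h, if_false, Finset.sum_const_zero, zero_add]
  have hr : ∀ j : Fin n, (G.degree (Sum.inr j) : ℚ)
      = ∑ i : Fin m, if G.Adj (Sum.inl i) (Sum.inr j) then 1 else 0 := by
    intro j
    have h : ∀ j' : Fin n, ¬ G.Adj (Sum.inr j) (Sum.inr j') := fun j' h => by
      simpa using hG h
    rw [← SimpleGraph.card_neighborFinset_eq_degree, SimpleGraph.neighborFinset_eq_filter,
      Finset.card_filter]
    rw [Fintype.sum_sum_type]
    push_cast
    simp only [h, if_false, Finset.sum_const_zero, add_zero, G.adj_comm (Sum.inr j)]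
  change ∑ v, (G.degree v : ℚ) * signVec m n v = 0
  rw [Fintype.sum_sum_type]
  simp only [hl, hr, signVec, Sum.elim_inl, Sum.elim_inr, mul_one, mul_neg,
    Finset.sum_neg_distrib]
  rw [Finset.sum_comm, add_neg_cancel]

open Classical in
/-- The degree sequence of a graph contained in `K_{m,n}`, as an element of `M_ℚ`. -/
noncomputable def degreeSeq {m n : ℕ} (G : SimpleGraph (Vert m n))
    (hG : G ≤ completeBipartiteGraph (Fin m) (Fin n)) : MQ m n :=
  ⟨fun v => (G.degree v : ℚ), degree_mem_MQ G hG⟩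

end EdgeCone

/-! For a set `B` of vertices, the functional `y ↦ ∑_{N(B)} y - ∑_B y` is non-negative on every edge
vector `e^i + f^j` of `G`. If `N(B)` is independent, it vanishes on exactly those edges which do not
cross the cut between `B ∪ N(B)` and its complement. For `B = A_i` these are the edges of `G{A}`,
so the functional is a point of `π(A)` and the sum of these points over `A ∈ S` vanishes on exactly
the edges of `G[S]`. The sum is therefore a relative interior point of the face spanned by `π(S)`,
which is cut out of `σ_G` by the edges of `G[S]`. Since `Val_S` is the sum of the edge vectors of
`G[S]`, all non-negative on `σ_G`, that face is also `H_{Val_S} ∩ σ_G`. Its span is the annihilator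
of the edges of `G[S]`, that is, the space of functions on the components of `G[S]` modulo
constants. -/

namespace EdgeCone

open Filter

section Pairing

variable {𝕜 M N : Type*} [Field 𝕜] [AddCommGroup M] [Module 𝕜 M] [AddCommGroup N] [Module 𝕜 N]
  (p : M →ₗ[𝕜] N →ₗ[𝕜] 𝕜)

/-- The common zeros of the functionals `p y`, `y ∈ t`. It extends `annihilator` from `pairing` to
an arbitrary bilinear pairing. -/
def commonKernel (t : Set M) : Submodule 𝕜 N := ⨅ y ∈ t, LinearMap.ker (p y)

variable {p} {s t : Set M} {x x₀ : N}

theorem mem_commonKernel : x ∈ commonKernel p t ↔ ∀ y ∈ t, p y x = 0 := by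
  simp only [commonKernel, Submodule.mem_iInf, LinearMap.mem_ker]

theorem finrank_span_add_finrank_commonKernel [FiniteDimensional 𝕜 N]
    (hp : Function.Injective p) (t : Set M) :
    Module.finrank 𝕜 (Submodule.span 𝕜 t) + Module.finrank 𝕜 (commonKernel p t) =
      Module.finrank 𝕜 N := by
  have hker : ((Submodule.span 𝕜 t).map p).dualCoannihilator = commonKernel p t := by
    ext x
    rw [← SetLike.mem_coe, Submodule.map_span, Submodule.coe_dualCoannihilator_span,
      mem_commonKernel, Set.mem_ofPred_eq, Set.forall_mem_image]
  rw [← hker, ← Subspace.finrank_add_finrank_dualCoannihilator_eq ((Submodule.span 𝕜 t).map p),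
    (Submodule.equivMapOfInjective p hp _).finrank_eq]

variable [LinearOrder 𝕜] [IsStrictOrderedRing 𝕜]

variable (p s t) in
/-- The part of the dual cone of `s` on which all functionals in `t` vanish. It extends `dualFace`
from `pairing` to an arbitrary bilinear pairing; for `t ⊆ s` it is a face. -/
def zeroFace : PointedCone 𝕜 N :=
  PointedCone.ofSubmodule (commonKernel p t) ⊓ PointedCone.dual p s

theorem mem_zeroFace : x ∈ zeroFace p s t ↔ x ∈ commonKernel p t ∧ x ∈ PointedCone.dual p s :=
  Iff.rfl

theorem isFaceOf_zeroFace (hts : t ⊆ s) :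
    (zeroFace p s t).IsFaceOf (PointedCone.dual p s) := by
  refine .of_mem_of_add_mem_left inf_le_right fun {x y} hx hy hxy => ⟨?_, hx⟩
  refine mem_commonKernel.2 fun z hz => ?_
  have hsum : p z x + p z y = 0 := by
    rw [← map_add]
    exact mem_commonKernel.1 hxy.1 z hz
  exact ((add_eq_zero_iff_of_nonneg (hx (hts hz)) (hy (hts hz))).1 hsum).1

theorem zeroFace_image_eq_ker_sum_inf_dual {ι : Type*} {I : Finset ι} {y : ι → M}
    (hy : ∀ i ∈ I, y i ∈ s) :
    zeroFace p s (y '' I) =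
      PointedCone.ofSubmodule (LinearMap.ker (p (∑ i ∈ I, y i))) ⊓ PointedCone.dual p s := by
  ext x
  refine and_congr_left fun hx => ?_
  change x ∈ commonKernel p (y '' I) ↔ x ∈ LinearMap.ker (p (∑ i ∈ I, y i))
  rw [mem_commonKernel, Set.forall_mem_image, LinearMap.mem_ker, map_sum, LinearMap.sum_apply,
    Finset.sum_eq_zero_iff_of_nonneg fun i hi => hx (hy i hi)]
  rfl

/-- For large `c` the functionals positive at `x₀` dominate, and the others vanish at `x`. -/
theorem exists_pos_smul_add_mem_dual (hs : s.Finite) (hx₀ : x₀ ∈ PointedCone.dual p s)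
    (hx : x ∈ commonKernel p {y ∈ s | p y x₀ = 0}) :
    ∃ c : 𝕜, 0 < c ∧ c • x₀ + x ∈ PointedCone.dual p s := by
  have hlarge : ∀ y ∈ s, ∀ᶠ c : 𝕜 in atTop, 0 ≤ c * p y x₀ + p y x := by
    intro y hy
    rcases (hx₀ hy).eq_or_lt with h | h
    · simp [← h, mem_commonKernel.1 hx y ⟨hy, h.symm⟩]
    · exact (tendsto_atTop_add_const_right _ _
        (tendsto_id.atTop_mul_const h)).eventually_ge_atTop 0
  obtain ⟨c, hc, hpos⟩ := (((eventually_all_finite hs).2 hlarge).and (eventually_gt_atTop 0)).exists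
  refine ⟨c, hpos, fun y hy => ?_⟩
  simpa only [map_add, map_smul, smul_eq_mul] using hc y hy

theorem zeroFace_le_of_isFaceOf (hs : s.Finite) {F : PointedCone 𝕜 N}
    (hF : F.IsFaceOf (PointedCone.dual p s)) (hx₀ : x₀ ∈ F) :
    zeroFace p s {y ∈ s | p y x₀ = 0} ≤ F := by
  intro x hx
  obtain ⟨c, hc, hmem⟩ := exists_pos_smul_add_mem_dual hs (hF.le hx₀) (neg_mem hx.1)
  refine hF.mem_of_add_mem_left hx.2 hmem ?_
  rw [add_neg_cancel_comm_assoc]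
  exact F.smul_mem hc.le hx₀

theorem span_zeroFace (hs : s.Finite) (hx₀ : x₀ ∈ PointedCone.dual p s) :
    Submodule.span 𝕜 (zeroFace p s {y ∈ s | p y x₀ = 0} : Set N) =
      commonKernel p {y ∈ s | p y x₀ = 0} := by
  refine le_antisymm (Submodule.span_le.2 fun x hx => hx.1) fun x hx => ?_
  obtain ⟨c, -, hmem⟩ := exists_pos_smul_add_mem_dual hs hx₀ hx
  have hx₀_ker : x₀ ∈ commonKernel p {y ∈ s | p y x₀ = 0} := mem_commonKernel.2 fun _ hy => hy.2
  have hx₀_span := Submodule.subset_span (R := 𝕜) (mem_zeroFace.2 ⟨hx₀_ker, hx₀⟩)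
  have hsum_span := Submodule.subset_span (R := 𝕜)
    (mem_zeroFace.2 ⟨add_mem (Submodule.smul_mem _ c hx₀_ker) hx, hmem⟩)
  simpa using sub_mem hsum_span (Submodule.smul_mem _ c hx₀_span)

end Pairing

section SpannedFace

variable {M N ι : Type*} [AddCommGroup M] [Module ℚ M] [AddCommGroup N] [Module ℚ N]

theorem isFaceSpannedBy_zeroFace {p : M →ₗ[ℚ] N →ₗ[ℚ] ℚ} {s : Set M} (hs : s.Finite)
    {S : Finset ι} {ρ : ι → PointedCone ℚ N} {x : ι → N} (hx : ∀ i ∈ S, x i ∈ ρ i)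
    (hρ : ∀ i ∈ S, ρ i ≤ zeroFace p s {y ∈ s | p y (x i) = 0}) :
    IsFaceSpannedBy (PointedCone.dual p s) (ρ '' S)
      (zeroFace p s {y ∈ s | p y (∑ i ∈ S, x i) = 0}) := by
  refine ⟨⟨isFaceOf_zeroFace (Set.sep_subset _ _), ?_⟩, ?_⟩
  · rintro _ ⟨i, hi, rfl⟩ z hz
    have hz_face := hρ i hi hz
    refine ⟨mem_commonKernel.2 fun y hy => mem_commonKernel.1 hz_face.1 y ⟨hy.1, ?_⟩, hz_face.2⟩
    have hsum := hy.2
    rw [map_sum, Finset.sum_eq_zero_iff_of_nonneg fun j hj => (hρ j hj (hx j hj)).2 hy.1] at hsum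
    exact hsum i hi
  · rintro F ⟨hF, hρF⟩
    exact zeroFace_le_of_isFaceOf hs hF
      (sum_mem fun i hi => hρF _ (Set.mem_image_of_mem ρ hi) (hx i hi))

theorem isFaceSpannedBy_iSup {σ : PointedCone ℚ N} {S : Finset ι} {ρ : ι → PointedCone ℚ N}
    (h : (⨆ i ∈ S, ρ i).IsFaceOf σ) : IsFaceSpannedBy σ (ρ '' S) (⨆ i ∈ S, ρ i) := by
  refine ⟨⟨h, ?_⟩, fun F hF => iSup₂_le fun i hi => hF.2 _ (Set.mem_image_of_mem ρ hi)⟩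
  rintro _ ⟨i, hi, rfl⟩
  exact le_iSup₂_of_le i hi le_rfl

end SpannedFace

theorem exists_comp_connectedComponentMk_eq {V α : Type*} {H : SimpleGraph V} {f : V → α}
    (hf : ∀ ⦃u v⦄, H.Adj u v → f u = f v) : ∃ g, g ∘ H.connectedComponentMk = f := by
  have hreach : ∀ u v, H.Reachable u v → f u = f v := by
    rintro u v ⟨w⟩
    induction w with
    | nil => rfl
    | cons huv _ ih => exact (hf huv).trans ih
  exact ⟨Quot.lift f hreach, rfl⟩

variable {m n : ℕ} {G H : SimpleGraph (Vert m n)} {A B : Finset (Vert m n)}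
  {S : Finset (Finset (Vert m n))} {i : Fin m} {j : Fin n}

theorem pairing_edgeVec_mk (i : Fin m) (j : Fin n) (x : Vert m n → ℚ) :
    pairing m n (edgeVec i j) (Submodule.Quotient.mk x) = x (Sum.inl i) + x (Sum.inr j) := by
  simp [pairing_mk, edgeVec, Pi.single_apply, add_mul, Finset.sum_add_distrib]

theorem pairing_injective (m n : ℕ) : Function.Injective (pairing m n) := by
  rw [injective_iff_map_eq_zero]
  intro y hy
  ext v
  simpa [pairing_mk, Pi.single_apply] using
    LinearMap.congr_fun hy (Submodule.Quotient.mk (Pi.single v 1))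

/-- The generators `e^i + f^j` of `σ_H^∨`. -/
def edgeVecs (H : SimpleGraph (Vert m n)) : Set (MQ m n) :=
  {y | ∃ i j, H.Adj (Sum.inl i) (Sum.inr j) ∧ y = edgeVec i j}

theorem edgeCone_eq_dual_edgeVecs (G : SimpleGraph (Vert m n)) :
    edgeCone G = PointedCone.dual (pairing m n) (edgeVecs G) :=
  PointedCone.dual_hull _

theorem span_dualEdgeCone (H : SimpleGraph (Vert m n)) :
    Submodule.span ℚ (dualEdgeCone H : Set (MQ m n)) = Submodule.span ℚ (edgeVecs H) :=
  le_antisymm (Submodule.span_le.2 (PointedCone.hull_le_span (R := ℚ) (edgeVecs H)))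
    (Submodule.span_mono PointedCone.subset_hull)

theorem signVec_mul_signVec (m n : ℕ) : signVec m n * signVec m n = 1 := by
  ext (i | j) <;> simp [signVec]

theorem signVec_mul_eq_of_adj (hH : H ≤ completeBipartiteGraph (Fin m) (Fin n))
    {x : Vert m n → ℚ}
    (hx : ∀ i j, H.Adj (Sum.inl i) (Sum.inr j) → x (Sum.inl i) + x (Sum.inr j) = 0)
    {u v : Vert m n} (huv : H.Adj u v) : (signVec m n * x) u = (signVec m n * x) v := by
  rcases u with i | j <;> rcases v with i' | j'
  · simpa using hH huv
  · simpa [signVec, add_eq_zero_iff_eq_neg] using hx i j' huv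
  · simpa [signVec, neg_eq_iff_add_eq_zero, add_comm] using hx i' j huv.symm
  · simpa using hH huv

/-- The map sending a function `g` on the components of `H` to the class of the vector with value
`g` on `U₁` and `-g` on `U₂`. It parametrizes the annihilator of the edge vectors of `H`. -/
def componentMap (H : SimpleGraph (Vert m n)) : (H.ConnectedComponent → ℚ) →ₗ[ℚ] NQ m n :=
  Submodule.mkQ _ ∘ₗ LinearMap.mulLeft ℚ (signVec m n) ∘ₗ
    LinearMap.funLeft ℚ ℚ H.connectedComponentMk

theorem componentMap_apply (H : SimpleGraph (Vert m n)) (g : H.ConnectedComponent → ℚ) :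
    componentMap H g = Submodule.Quotient.mk (signVec m n * g ∘ H.connectedComponentMk) :=
  rfl

theorem range_componentMap (hH : H ≤ completeBipartiteGraph (Fin m) (Fin n)) :
    LinearMap.range (componentMap H) = commonKernel (pairing m n) (edgeVecs H) := by
  apply le_antisymm
  · rintro _ ⟨g, rfl⟩
    rw [mem_commonKernel]
    rintro _ ⟨i, j, hij, rfl⟩
    rw [componentMap_apply, pairing_edgeVec_mk]
    simp [signVec, SimpleGraph.ConnectedComponent.connectedComponentMk_eq_of_adj hij]
  · intro z hz
    obtain ⟨x, rfl⟩ := Submodule.Quotient.mk_surjective _ z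
    have hx : ∀ i j, H.Adj (Sum.inl i) (Sum.inr j) → x (Sum.inl i) + x (Sum.inr j) = 0 := by
      intro i j hij
      rw [← pairing_edgeVec_mk]
      exact mem_commonKernel.1 hz _ ⟨i, j, hij, rfl⟩
    obtain ⟨g, hg⟩ := exists_comp_connectedComponentMk_eq
      fun _ _ huv => signVec_mul_eq_of_adj hH hx huv
    exact ⟨g, by rw [componentMap_apply, hg, ← mul_assoc, signVec_mul_signVec, one_mul]⟩

theorem ker_componentMap (H : SimpleGraph (Vert m n)) :
    LinearMap.ker (componentMap H) = Submodule.span ℚ {1} := by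
  ext g
  rw [LinearMap.mem_ker, componentMap_apply, Submodule.Quotient.mk_eq_zero,
    Submodule.mem_span_singleton, Submodule.mem_span_singleton]
  refine exists_congr fun c => ⟨fun h => ?_, ?_⟩
  · have hcomp : c • 1 = g ∘ H.connectedComponentMk := by
      rw [← one_mul (g ∘ _), ← signVec_mul_signVec, mul_assoc, ← h, mul_smul_comm]
    exact funext <| SimpleGraph.ConnectedComponent.ind (congrFun hcomp)
  · rintro rfl
    ext v
    simp [mul_comm]

theorem finrank_commonKernel_edgeVecs_add_one [Nonempty (Vert m n)]
    (hH : H ≤ completeBipartiteGraph (Fin m) (Fin n)) :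
    Module.finrank ℚ (commonKernel (pairing m n) (edgeVecs H)) + 1 = numComponents H := by
  classical
  have hker : Module.finrank ℚ (LinearMap.ker (componentMap H)) = 1 := by
    rw [ker_componentMap, finrank_span_singleton one_ne_zero]
  rw [← range_componentMap hH, ← hker, LinearMap.finrank_range_add_finrank_ker,
    Module.finrank_pi, numComponents, Nat.card_eq_fintype_card]

theorem finrank_NQ_add_one (m n : ℕ) [Nonempty (Vert m n)] :
    Module.finrank ℚ (NQ m n) + 1 = m + n := by
  have hne : signVec m n ≠ 0 := fun h => by simpa [h] using signVec_mul_signVec m n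
  rw [← finrank_span_singleton (K := ℚ) hne, Submodule.finrank_quotient_add_finrank]
  simp

theorem coneDim_dualEdgeCone_add_numComponents [Nonempty (Vert m n)]
    (hH : H ≤ completeBipartiteGraph (Fin m) (Fin n)) :
    coneDim (dualEdgeCone H) + numComponents H = m + n := by
  rw [coneDim, span_dualEdgeCone, ← finrank_commonKernel_edgeVecs_add_one hH, ← add_assoc,
    finrank_span_add_finrank_commonKernel (pairing_injective m n), finrank_NQ_add_one]

open Classical in
/-- The edges of a subgraph of `K_{m,n}`, as pairs of indices. -/
noncomputable def edgePairs (H : SimpleGraph (Vert m n)) : Finset (Fin m × Fin n) :=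
  Finset.univ.filter fun e => H.Adj (Sum.inl e.1) (Sum.inr e.2)

theorem image_edgePairs (H : SimpleGraph (Vert m n)) :
    (fun e : Fin m × Fin n => edgeVec e.1 e.2) '' edgePairs H = edgeVecs H := by
  ext y
  simp [edgePairs, edgeVecs, eq_comm]

theorem finite_edgeVecs (H : SimpleGraph (Vert m n)) : (edgeVecs H).Finite := by
  rw [← image_edgePairs]
  exact (Finset.finite_toSet _).image _

theorem edgeVecs_mono (hHG : H ≤ G) : edgeVecs H ⊆ edgeVecs G := by
  rintro _ ⟨i, j, hij, rfl⟩
  exact ⟨i, j, hHG hij, rfl⟩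

theorem degreeSeq_eq_sum_edgeVec (hH : H ≤ completeBipartiteGraph (Fin m) (Fin n)) :
    degreeSeq H hH = ∑ e ∈ edgePairs H, edgeVec e.1 e.2 := by
  classical
  have hll (i i' : Fin m) : ¬ H.Adj (Sum.inl i) (Sum.inl i') := fun h => by simpa using hH h
  have hrr (j j' : Fin n) : ¬ H.Adj (Sum.inr j) (Sum.inr j') := fun h => by simpa using hH h
  ext v
  change (H.degree v : ℚ) = _
  rw [SimpleGraph.degree_eq_sum_if_adj, Fintype.sum_sum_type, edgePairs, Finset.sum_filter,
    Fintype.sum_prod_type]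
  simp only [AddSubmonoidClass.coe_finsetSum, Finset.sum_apply]
  rcases v with i | j
  · simp only [hll, if_false, Finset.sum_const_zero, zero_add]
    rw [eq_comm, Finset.sum_eq_single i]
    · simp [edgeVec, apply_ite, ite_apply]
    · intro i' _ hne
      simp [edgeVec, apply_ite, ite_apply, hne.symm]
    · simp
  · simp only [hrr, if_false, Finset.sum_const_zero, add_zero]
    rw [eq_comm, Finset.sum_comm, Finset.sum_eq_single j]
    · simp [edgeVec, apply_ite, ite_apply, H.adj_comm (Sum.inr j)]
    · intro j' _ hne
      simp [edgeVec, apply_ite, ite_apply, hne.symm]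
    · simp

theorem hyperplaneSection_degreeSeq (hHG : H ≤ G)
    (hH : H ≤ completeBipartiteGraph (Fin m) (Fin n)) :
    hyperplaneSection G (degreeSeq H hH) = zeroFace (pairing m n) (edgeVecs G) (edgeVecs H) := by
  rw [hyperplaneSection, hyperplane, edgeCone_eq_dual_edgeVecs, degreeSeq_eq_sum_edgeVec,
    ← image_edgePairs H, zeroFace_image_eq_ker_sum_inf_dual]
  intro e he
  exact edgeVecs_mono hHG (image_edgePairs H ▸ Set.mem_image_of_mem _ he)

open Classical in
/-- The class of `𝟙_{N(B)} - 𝟙_B`, a point of the relative interior of `π(A)` for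
`B = chosenSide A`. -/
noncomputable def rayVec (G : SimpleGraph (Vert m n)) (B : Finset (Vert m n)) : NQ m n :=
  Submodule.Quotient.mk fun v => (if v ∈ nbr G B then 1 else 0) - (if v ∈ B then 1 else 0)

theorem mem_indepHyperplane_iff {y : MQ m n} :
    y ∈ indepHyperplane G B ↔ pairing m n y (rayVec G B) = 0 := by
  classical
  rw [rayVec, pairing_mk]
  simp only [mul_sub, mul_ite, mul_one, mul_zero, Finset.sum_sub_distrib, Finset.sum_ite_mem,
    Finset.univ_inter, sub_eq_zero]
  exact eq_comm

theorem mem_nbr {v : Vert m n} : v ∈ nbr G B ↔ ∃ u ∈ B, G.Adj u v := by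
  simp [nbr]

-- Grouped so that both brackets are non-negative when `(i, j)` is an edge of `G`.
open Classical in
theorem pairing_edgeVec_rayVec (G : SimpleGraph (Vert m n)) (B : Finset (Vert m n))
    (i : Fin m) (j : Fin n) :
    pairing m n (edgeVec i j) (rayVec G B) =
      ((if Sum.inr j ∈ nbr G B then 1 else 0) - (if Sum.inl i ∈ B then 1 else 0)) +
      ((if Sum.inl i ∈ nbr G B then 1 else 0) - (if Sum.inr j ∈ B then 1 else 0)) := by
  rw [rayVec, pairing_edgeVec_mk]
  ring

theorem rayVec_mem_edgeCone (G : SimpleGraph (Vert m n)) (B : Finset (Vert m n)) :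
    rayVec G B ∈ edgeCone G := by
  rw [edgeCone_eq_dual_edgeVecs, PointedCone.mem_dual]
  rintro _ ⟨i, j, hij, rfl⟩
  have hj : Sum.inl i ∈ B → Sum.inr j ∈ nbr G B := fun hi => mem_nbr.2 ⟨_, hi, hij⟩
  have hi : Sum.inr j ∈ B → Sum.inl i ∈ nbr G B := fun hj => mem_nbr.2 ⟨_, hj, hij.symm⟩
  rw [pairing_edgeVec_rayVec]
  split_ifs <;> simp_all

theorem inducedOn_adj {P : Finset (Vert m n)} {u v : Vert m n} :
    (inducedOn G P).Adj u v ↔ G.Adj u v ∧ u ∈ P ∧ v ∈ P := by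
  simp only [inducedOn, SimpleGraph.map_adj, SimpleGraph.comap_adj,
    Function.Embedding.subtype_apply, Subtype.exists, Finset.mem_coe]
  grind

theorem sup_inducedOn_compl_adj {P : Finset (Vert m n)} {u v : Vert m n} :
    (inducedOn G P ⊔ inducedOn G Pᶜ).Adj u v ↔ G.Adj u v ∧ (u ∈ P ↔ v ∈ P) := by
  simp only [SimpleGraph.sup_adj, inducedOn_adj, Finset.mem_compl]
  tauto

theorem compl_U₁ (m n : ℕ) : (U₁ m n)ᶜ = U₂ m n := by
  ext (i | j) <;> simp [U₁, U₂]

theorem mem_U₁_iff_mem_U₂_of_adj (hG : G ≤ completeBipartiteGraph (Fin m) (Fin n))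
    {u v : Vert m n} (huv : G.Adj u v) : u ∈ U₁ m n ↔ v ∈ U₂ m n := by
  have := hG huv
  rcases u with i | j <;> rcases v with i' | j' <;> simp_all [U₁, U₂]

theorem isIndepSet_U₁ (hG : G ≤ completeBipartiteGraph (Fin m) (Fin n)) :
    G.IsIndepSet (U₁ m n : Set (Vert m n)) := by
  intro u hu v hv _ huv
  have hv₂ := (mem_U₁_iff_mem_U₂_of_adj hG huv).1 hu
  rw [← compl_U₁] at hv₂
  exact Finset.mem_compl.1 hv₂ hv

theorem isIndepSet_U₂ (hG : G ≤ completeBipartiteGraph (Fin m) (Fin n)) :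
    G.IsIndepSet (U₂ m n : Set (Vert m n)) := by
  intro u hu v hv _ huv
  have hu₁ := (mem_U₁_iff_mem_U₂_of_adj hG huv).2 hv
  rw [← compl_U₁] at hu
  exact Finset.mem_compl.1 hu hu₁

theorem nbr_inter_U₁ (hG : G ≤ completeBipartiteGraph (Fin m) (Fin n))
    (A : Finset (Vert m n)) : nbr G (A ∩ U₁ m n) = nbr G A ∩ U₂ m n := by
  ext v
  simp only [Finset.mem_inter, mem_nbr]
  grind [mem_U₁_iff_mem_U₂_of_adj hG]

theorem nbr_inter_U₂ (hG : G ≤ completeBipartiteGraph (Fin m) (Fin n))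
    (A : Finset (Vert m n)) : nbr G (A ∩ U₂ m n) = nbr G A ∩ U₁ m n := by
  ext v
  simp only [Finset.mem_inter, mem_nbr]
  grind [mem_U₁_iff_mem_U₂_of_adj hG, SimpleGraph.Adj.symm]

theorem nbr_eq_compl_of_maximal (hA : Maximal (IsIndependent G) A) : nbr G A = Aᶜ := by
  ext v
  rw [Finset.mem_compl, mem_nbr]
  refine ⟨fun ⟨u, hu, huv⟩ hv => hA.prop.2 hu hv huv.ne huv, fun hv => ?_⟩
  by_contra! hno
  have hins : IsIndependent G (insert v A) := by
    refine ⟨Finset.insert_nonempty v A, ?_⟩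
    rw [Finset.coe_insert, SimpleGraph.isIndepSet_iff, Set.pairwise_insert]
    exact ⟨hA.prop.2, fun u hu _ => ⟨fun h => hno u hu h.symm, hno u hu⟩⟩
  exact hv (hA.le_of_ge hins (Finset.subset_insert v A) (Finset.mem_insert_self v A))

/-- The sets `A` for which `G{A}` splits `G` along `A_i ∪ N(A_i)` and its complement. All members
of `I_G^(*)` are of this kind. -/
def IsOneSidedOrMaximal (G : SimpleGraph (Vert m n)) (A : Finset (Vert m n)) : Prop :=
  A ⊆ U₁ m n ∨ A ⊆ U₂ m n ∨ Maximal (IsIndependent G) A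

theorem IsStarSet.isOneSidedOrMaximal (hA : IsStarSet G A) : IsOneSidedOrMaximal G A := by
  rcases hA with ⟨-, hmax⟩ | ⟨-, ⟨u, -, rfl⟩ | ⟨u, -, rfl⟩, -⟩
  · exact .inr (.inr hmax)
  · exact .inl Finset.sdiff_subset
  · exact .inr (.inl Finset.sdiff_subset)

theorem chosenSide_of_subset_U₁ (hA : A ⊆ U₁ m n) : chosenSide A = A := by
  rw [chosenSide, Finset.inter_eq_left.2 hA]
  split_ifs with h
  · rfl
  · rw [Finset.not_nonempty_iff_eq_empty.1 h, Finset.empty_inter]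

theorem chosenSide_of_subset_U₂ (hA : A ⊆ U₂ m n) : chosenSide A = A := by
  have hA₁ : A ∩ U₁ m n = ∅ := by
    rwa [← Finset.disjoint_iff_inter_eq_empty, ← Finset.subset_compl_iff_disjoint_right, compl_U₁]
  rw [chosenSide, hA₁, if_neg Finset.not_nonempty_empty, Finset.inter_eq_left.2 hA]

theorem chosenSide_of_not_subset_U₂ (hA : ¬ A ⊆ U₂ m n) : chosenSide A = A ∩ U₁ m n := by
  rw [← compl_U₁, Finset.subset_compl_iff_disjoint_right] at hA
  exact if_pos (Finset.not_disjoint_iff_nonempty_inter.1 hA)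

theorem assocGraph_eq (hG : G ≤ completeBipartiteGraph (Fin m) (Fin n))
    (hA : IsOneSidedOrMaximal G A) :
    assocGraph G A = inducedOn G (chosenSide A ∪ nbr G (chosenSide A)) ⊔
      inducedOn G (chosenSide A ∪ nbr G (chosenSide A))ᶜ := by
  unfold assocGraph
  split_ifs with h₁ h₂
  · have hN := nbr_inter_U₁ hG A
    rw [Finset.inter_eq_left.2 h₁] at hN
    rw [chosenSide_of_subset_U₁ h₁]
    rw [← compl_U₁] at hN ⊢
    congr 2
    grind [Finset.mem_compl]
  · have hN := nbr_inter_U₂ hG A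
    rw [Finset.inter_eq_left.2 h₂] at hN
    rw [chosenSide_of_subset_U₂ h₂]
    rw [← compl_U₁] at h₂ ⊢
    congr 2
    grind [Finset.mem_compl]
  · have hN := nbr_eq_compl_of_maximal ((hA.resolve_left h₁).resolve_left h₂)
    rw [chosenSide_of_not_subset_U₂ h₂, nbr_inter_U₁ hG, nbr_inter_U₂ hG, hN, ← compl_U₁]
    congr 2
    grind [Finset.mem_compl]

theorem isIndepSet_nbr_chosenSide (hG : G ≤ completeBipartiteGraph (Fin m) (Fin n))
    (A : Finset (Vert m n)) : G.IsIndepSet (nbr G (chosenSide A) : Set (Vert m n)) := by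
  rw [chosenSide]
  split_ifs
  · rw [nbr_inter_U₁ hG]
    exact (isIndepSet_U₂ hG).mono (Finset.coe_subset.2 Finset.inter_subset_right)
  · rw [nbr_inter_U₂ hG]
    exact (isIndepSet_U₁ hG).mono (Finset.coe_subset.2 Finset.inter_subset_right)

theorem pairing_edgeVec_rayVec_eq_zero_iff (hB : G.IsIndepSet (nbr G B : Set (Vert m n)))
    (hij : G.Adj (Sum.inl i) (Sum.inr j)) :
    pairing m n (edgeVec i j) (rayVec G B) = 0 ↔
      (Sum.inl i ∈ B ∪ nbr G B ↔ Sum.inr j ∈ B ∪ nbr G B) := by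
  have hj : Sum.inl i ∈ B → Sum.inr j ∈ nbr G B := fun hi => mem_nbr.2 ⟨_, hi, hij⟩
  have hi : Sum.inr j ∈ B → Sum.inl i ∈ nbr G B := fun hj => mem_nbr.2 ⟨_, hj, hij.symm⟩
  have hnot : ¬ (Sum.inl i ∈ nbr G B ∧ Sum.inr j ∈ nbr G B) :=
    fun h => hB h.1 h.2 hij.ne hij
  rw [pairing_edgeVec_rayVec, Finset.mem_union, Finset.mem_union]
  split_ifs <;> simp_all

theorem assocGraph_adj_iff (hG : G ≤ completeBipartiteGraph (Fin m) (Fin n))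
    (hA : IsOneSidedOrMaximal G A) (hij : G.Adj (Sum.inl i) (Sum.inr j)) :
    (assocGraph G A).Adj (Sum.inl i) (Sum.inr j) ↔
      pairing m n (edgeVec i j) (rayVec G (chosenSide A)) = 0 := by
  rw [assocGraph_eq hG hA, sup_inducedOn_compl_adj, and_iff_right hij,
    pairing_edgeVec_rayVec_eq_zero_iff (isIndepSet_nbr_chosenSide hG A) hij]

theorem rayVec_mem_extremalRay (G : SimpleGraph (Vert m n)) (A : Finset (Vert m n)) :
    rayVec G (chosenSide A) ∈ extremalRay G A :=
  ⟨mem_commonKernel.2 fun _ hy => mem_indepHyperplane_iff.1 hy.1, rayVec_mem_edgeCone G _⟩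

theorem extremalRay_le_zeroFace (G : SimpleGraph (Vert m n)) (A : Finset (Vert m n)) :
    extremalRay G A ≤ zeroFace (pairing m n) (edgeVecs G)
      {y ∈ edgeVecs G | pairing m n y (rayVec G (chosenSide A)) = 0} := by
  rintro x ⟨hx, hxG⟩
  refine ⟨mem_commonKernel.2 fun y hy => ?_, edgeCone_eq_dual_edgeVecs G ▸ hxG⟩
  exact mem_commonKernel.1 hx y
    ⟨mem_indepHyperplane_iff.2 hy.2, PointedCone.subset_hull hy.1⟩

theorem interGraph_adj {u v : Vert m n} :
    (interGraph G S).Adj u v ↔ G.Adj u v ∧ ∀ A ∈ S, (assocGraph G A).Adj u v := by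
  simp only [interGraph, SimpleGraph.inf_adj, SimpleGraph.iInf_adj]
  grind [SimpleGraph.Adj.ne]

theorem edgeVecs_interGraph (hG : G ≤ completeBipartiteGraph (Fin m) (Fin n))
    (hS : ∀ A ∈ S, IsOneSidedOrMaximal G A) :
    edgeVecs (interGraph G S) =
      {y ∈ edgeVecs G | pairing m n y (∑ A ∈ S, rayVec G (chosenSide A)) = 0} := by
  have hadj {i j} (hij : G.Adj (Sum.inl i) (Sum.inr j)) :
      (interGraph G S).Adj (Sum.inl i) (Sum.inr j) ↔
        pairing m n (edgeVec i j) (∑ A ∈ S, rayVec G (chosenSide A)) = 0 := by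
    rw [map_sum, Finset.sum_eq_zero_iff_of_nonneg, interGraph_adj, and_iff_right hij]
    · exact forall₂_congr fun A hA => assocGraph_adj_iff hG (hS A hA) hij
    · intro A _
      exact rayVec_mem_edgeCone G _ (PointedCone.subset_hull ⟨i, j, hij, rfl⟩)
  ext y
  constructor
  · rintro ⟨i, j, hij, rfl⟩
    have hij' := interGraph_le G S hij
    exact ⟨⟨i, j, hij', rfl⟩, (hadj hij').1 hij⟩
  · rintro ⟨⟨i, j, hij, rfl⟩, hy⟩
    exact ⟨i, j, (hadj hij).2 hy, rfl⟩

theorem isFaceSpannedBy_hyperplaneSection (hG : G ≤ completeBipartiteGraph (Fin m) (Fin n))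
    (hS : ∀ A ∈ S, IsOneSidedOrMaximal G A) :
    IsFaceSpannedBy (edgeCone G) (extremalRay G '' S)
      (hyperplaneSection G (degreeSeq (interGraph G S) ((interGraph_le G S).trans hG))) := by
  rw [hyperplaneSection_degreeSeq (interGraph_le G S), edgeVecs_interGraph hG hS,
    edgeCone_eq_dual_edgeVecs]
  exact isFaceSpannedBy_zeroFace (finite_edgeVecs G) (fun A _ => rayVec_mem_extremalRay G A)
    fun A _ => extremalRay_le_zeroFace G A

theorem coneDim_hyperplaneSection_add_one [Nonempty (Vert m n)]
    (hG : G ≤ completeBipartiteGraph (Fin m) (Fin n))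
    (hS : ∀ A ∈ S, IsOneSidedOrMaximal G A) :
    coneDim (hyperplaneSection G
      (degreeSeq (interGraph G S) ((interGraph_le G S).trans hG))) + 1 =
        numComponents (interGraph G S) := by
  have hsum : ∑ A ∈ S, rayVec G (chosenSide A) ∈
      PointedCone.dual (pairing m n) (edgeVecs G) := by
    rw [← edgeCone_eq_dual_edgeVecs]
    exact sum_mem fun A _ => rayVec_mem_edgeCone G _
  rw [hyperplaneSection_degreeSeq (interGraph_le G S), coneDim,
    ← finrank_commonKernel_edgeVecs_add_one ((interGraph_le G S).trans hG),
    edgeVecs_interGraph hG hS, span_zeroFace (finite_edgeVecs G) hsum]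

end EdgeCone

theorem mainTheorem4_general (m n d : ℕ) (G : SimpleGraph (Fin m ⊕ Fin n))
    (hG : G ≤ completeBipartiteGraph (Fin m) (Fin n)) [Nonempty (Fin m ⊕ Fin n)]
    (S : Finset (Finset (Fin m ⊕ Fin n)))
    (hS : ∀ A ∈ S, EdgeCone.IsOneSidedOrMaximal G A) :
    ((∃ τ, EdgeCone.IsFaceSpannedBy (EdgeCone.edgeCone G)
          (EdgeCone.extremalRay G '' (S : Set (Finset (Fin m ⊕ Fin n)))) τ ∧
          EdgeCone.coneDim τ = d) ↔
        (EdgeCone.coneDim (EdgeCone.dualEdgeCone (EdgeCone.interGraph G S)) : ℤ)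
          = (m : ℤ) + n - d - 1) ∧
    ((EdgeCone.coneDim (EdgeCone.dualEdgeCone (EdgeCone.interGraph G S)) : ℤ)
          = (m : ℤ) + n - d - 1 ↔
        EdgeCone.numComponents (EdgeCone.interGraph G S) = d + 1) ∧
    EdgeCone.IsFaceSpannedBy (EdgeCone.edgeCone G)
      (EdgeCone.extremalRay G '' (S : Set (Finset (Fin m ⊕ Fin n))))
      (EdgeCone.hyperplaneSection G (EdgeCone.degreeSeq (EdgeCone.interGraph G S)
        ((EdgeCone.interGraph_le G S).trans hG))) ∧
    ((⨆ A ∈ S, EdgeCone.extremalRay G A).IsFaceOf (EdgeCone.edgeCone G) →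
      EdgeCone.coneDim (⨆ A ∈ S, EdgeCone.extremalRay G A) = d →
        EdgeCone.numComponents (EdgeCone.interGraph G S) = d + 1 ∧
        (⨆ A ∈ S, EdgeCone.extremalRay G A) =
          EdgeCone.hyperplaneSection G (EdgeCone.degreeSeq (EdgeCone.interGraph G S)
            ((EdgeCone.interGraph_le G S).trans hG))) := by
  have hface := EdgeCone.isFaceSpannedBy_hyperplaneSection hG hS
  have hdim := EdgeCone.coneDim_hyperplaneSection_add_one hG hS
  have hdual := EdgeCone.coneDim_dualEdgeCone_add_numComponents
    ((EdgeCone.interGraph_le G S).trans hG)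
  refine ⟨⟨?_, fun h => ⟨_, hface, by omega⟩⟩, by omega, hface, fun hcone hd => ?_⟩
  · rintro ⟨τ, hτ, hd⟩
    rw [hτ.unique hface] at hd
    omega
  · have heq := (EdgeCone.isFaceSpannedBy_iSup hcone).unique hface
    rw [heq] at hd
    exact ⟨by omega, heq⟩

theorem mainTheorem4 (m n d : ℕ) (G : SimpleGraph (Fin m ⊕ Fin n))
    (hG : G ≤ completeBipartiteGraph (Fin m) (Fin n)) (hconn : G.Connected)
    (S : Finset (Finset (Fin m ⊕ Fin n)))
    (hS : ∀ A ∈ S, EdgeCone.IsFirstIndependent G A) (hd : S.card = d) :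
    -- the rays `π(S)` span a face of dimension `d` iff `dim σ_{G[S]}^∨ = m + n - d - 1`
    ((∃ τ, EdgeCone.IsFaceSpannedBy (EdgeCone.edgeCone G)
          (EdgeCone.extremalRay G '' (S : Set (Finset (Fin m ⊕ Fin n)))) τ ∧
          EdgeCone.coneDim τ = d) ↔
        (EdgeCone.coneDim (EdgeCone.dualEdgeCone (EdgeCone.interGraph G S)) : ℤ)
          = (m : ℤ) + n - d - 1) ∧
    -- equivalently, iff `G[S]` has `d + 1` connected components
    ((EdgeCone.coneDim (EdgeCone.dualEdgeCone (EdgeCone.interGraph G S)) : ℤ)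
          = (m : ℤ) + n - d - 1 ↔
        EdgeCone.numComponents (EdgeCone.interGraph G S) = d + 1) ∧
    -- the face spanned by `π(S)` is `H_{Val_S} ∩ σ_G`
    EdgeCone.IsFaceSpannedBy (EdgeCone.edgeCone G)
      (EdgeCone.extremalRay G '' (S : Set (Finset (Fin m ⊕ Fin n))))
      (EdgeCone.hyperplaneSection G (EdgeCone.degreeSeq (EdgeCone.interGraph G S)
        ((EdgeCone.interGraph_le G S).trans hG))) ∧
    -- if the cone generated by `π(S)` is itself a face of dimension `d`, then it is this face
    ((⨆ A ∈ S, EdgeCone.extremalRay G A).IsFaceOf (EdgeCone.edgeCone G) →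
      EdgeCone.coneDim (⨆ A ∈ S, EdgeCone.extremalRay G A) = d →
        EdgeCone.numComponents (EdgeCone.interGraph G S) = d + 1 ∧
        (⨆ A ∈ S, EdgeCone.extremalRay G A) =
          EdgeCone.hyperplaneSection G (EdgeCone.degreeSeq (EdgeCone.interGraph G S)
            ((EdgeCone.interGraph_le G S).trans hG))) := by
  have := hconn.nonempty
  exact mainTheorem4_general m n d G hG S fun A hA => (hS A hA).1.isOneSidedOrMaximal
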